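/- Let $n\ge 0$ be an integer and let $A,B$ be real symmetric positive definite $n\times n$ matrices. Put $$X_A=\{x\in\mathbb{R}^n: Ax\cdot x\le 1\},\qquad P_B=\{p\in\mathbb{R}^n: Bp\cdot p\le 1\},$$ and for $X\subset\mathbb{R}^n$ let $X^o=\{p\in\mathbb{R}^n: p\cdot x\le 1\text{ for all }x\in X\}$ be its polar dual. A pair $(X,P)$ of centrally symmetric convex bodies (compact convex sets with nonempty interior, invariant under $x\mapsto -x$) is called a dual pair if $X^o\subset P$. Let $F$ be the unitary Fourier transform on $L^2(\mathbb{R}^n)$ (complex-valued functions), the extension of $F\psi(p)=(2\pi)^{-n/2}\int_{\mathbb{R}^n}e^{-ip\cdot x}\psi(x)\,dx$ from $L^1\cap L^2$. We say that $\psi\in L^2(\mathbb{R}^n)$ satisfies the Hardy inequalities for $(A,B)$ if there is a constant $C>0$ such that $$|\psi(x)|\le Ce^{-\frac12 Ax\cdot x}\quad\text{and}\quad |F\psi(p)|\le Ce^{-\frac12 Bp\cdot p}$$ for almost every $x$ and almost every $p$ in $\mathbb{R}^n$. Then: (i) there exists $\psi\in L^2(\mathbb{R}^n)$, $\psi\ne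 0$, satisfying the Hardy inequalities for $(A,B)$ if and only if $(X_A,P_B)$ is a dual pair; (ii) $X_A^o=P_B$ if and only if the nonzero $\psi\in L^2(\mathbb{R}^n)$ satisfying the Hardy inequalities for $(A,B)$ are exactly the Gaussians $\psi(x)=c\,e^{-\frac12 Ax\cdot x}$ (almost everywhere) with a constant $c\in\mathbb{C}$, $c\neq 0$. -/

import Mathlib

open MeasureTheory
open scoped FourierTransform

/-- Euclidean space `ℝⁿ` (used both for positions `x` and for momenta `p`). -/
abbrev EucSpace (n : ℕ) : Type := EuclideanSpace ℝ (Fin n)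

/-- The quadratic form `A x · x` of a real `n × n` matrix. -/
def quadForm {n : ℕ} (A : Matrix (Fin n) (Fin n) ℝ) (x : EucSpace n) : ℝ :=
  (A.mulVec x.ofLp) ⬝ᵥ x.ofLp

/-- The set `{x : A x · x ≤ 1}`. -/
def ellipsoid {n : ℕ} (A : Matrix (Fin n) (Fin n) ℝ) : Set (EucSpace n) :=
  {x | quadForm A x ≤ 1}

/-- The polar dual `Xᵒ = {p : p · x ≤ 1 for all x ∈ X}`. -/
def polarDual {n : ℕ} (X : Set (EucSpace n)) : Set (EucSpace n) :=
  {p | ∀ x ∈ X, inner ℝ p x ≤ 1}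

/-- Centrally symmetric convex bodies: compact convex sets with nonempty interior
and with `X = -X`. -/
structure IsSymmConvexBody {n : ℕ} (X : Set (EucSpace n)) : Prop where
  convex : Convex ℝ X
  isCompact : IsCompact X
  nonempty_interior : (interior X).Nonempty
  symm : ∀ x, x ∈ X ↔ -x ∈ X

/-- A dual pair: two centrally symmetric convex bodies with `Xᵒ ⊆ P`. -/
structure IsDualPair {n : ℕ} (X P : Set (EucSpace n)) : Prop where
  left : IsSymmConvexBody X
  right : IsSymmConvexBody P
  polar_subset : polarDual X ⊆ P

/-- The Hilbert space `L²(ℝⁿ)` of complex-valued functions. -/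
abbrev L2Space (n : ℕ) : Type := Lp ℂ 2 (volume : Measure (EucSpace n))

/-- The unitary Fourier transform
`F ψ(p) = (2π)^(-n/2) ∫ e^(-i p·x) ψ(x) dx` on `L²(ℝⁿ)`, obtained by rescaling Mathlib's `L²`
transform, whose kernel is `e^(-2π i p·x)`. Like every `L²` function, it is determined up to
null sets. -/
noncomputable def unitaryFourier {n : ℕ} (ψ : L2Space n) (p : EucSpace n) : ℂ :=
  (((1 / (2 * Real.pi)) ^ ((n : ℝ) / 2) : ℝ) : ℂ) *
    (𝓕 ψ : L2Space n) ((1 / (2 * Real.pi)) • p)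

open scoped ContDiff in
/-- On `L¹ ∩ L²` the `L²` transform of Mathlib is given by its integral. -/
theorem fourier_ae {n : ℕ} (ψ : L2Space n) (h : Integrable ψ) :
    (𝓕 ψ : L2Space n) =ᵐ[volume] 𝓕 (ψ : EucSpace n → ℂ) := by
  have hc : Continuous (𝓕 (ψ : EucSpace n → ℂ)) :=
    VectorFourier.fourierIntegral_continuous Real.continuous_fourierChar (by
      exact continuous_inner) h
  refine ae_eq_of_integral_contDiff_smul_eq
    ((Lp.memLp (𝓕 ψ : L2Space n)).locallyIntegrable (by norm_num)) hc.locallyIntegrable ?_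
  intro g hg hs
  have hs' : HasCompactSupport (Complex.ofRealCLM ∘ g) := hs.comp_left rfl
  have hg' : ContDiff ℝ ∞ (Complex.ofRealCLM ∘ g) := by fun_prop
  let G := hs'.toSchwartzMap hg'
  have h1 := congrArg (fun T => T G) (Lp.fourier_toTemperedDistribution_eq ψ)
  simp only [TemperedDistribution.fourier_apply, Lp.toTemperedDistribution_apply] at h1
  have h2 := VectorFourier.integral_fourierIntegral_smul_eq_flip (μ := volume) (ν := volume)
     (L := innerₗ (EucSpace n)) Real.continuous_fourierChar continuous_inner (f := G) (g := ψ) (G.integrable) h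
  have e1 : ∀ x, g x • (𝓕 ψ : L2Space n) x = G x • (𝓕 ψ : L2Space n) x := fun x => rfl
  have e2 : ∀ x, g x • 𝓕 (ψ : EucSpace n → ℂ) x = G x • 𝓕 (ψ : EucSpace n → ℂ) x := fun x => rfl
  simp_rw [e1, e2]
  rw [← h1]
  rw [flip_innerₗ] at h2
  exact h2

/-- On `L¹ ∩ L²` the transform `unitaryFourier` is given by its integral formula. -/
theorem unitaryFourier_ae_eq {n : ℕ} (ψ : L2Space n) (h : Integrable ψ) :
    ∀ᵐ p : EucSpace n, unitaryFourier ψ p =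
      (((1 / (2 * Real.pi)) ^ ((n : ℝ) / 2) : ℝ) : ℂ) *
        ∫ x : EucSpace n, Complex.exp (-(Complex.I * (inner ℝ p x : ℝ))) * ψ x := by
  have hr : (1 / (2 * Real.pi)) ≠ 0 := by positivity
  have hq := (Measure.quasiMeasurePreserving_smul (volume : Measure (EucSpace n)) hr).ae (fourier_ae ψ h)
  filter_upwards [hq] with p hp
  have hp' : (𝓕 ψ : L2Space n) ((1 / (2 * Real.pi)) • p) = 𝓕 (ψ : EucSpace n → ℂ) ((1 / (2 * Real.pi)) • p) := hp
  rw [unitaryFourier, hp', Real.fourier_eq']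
  congr 1
  refine integral_congr_ae (.of_forall fun x => ?_)
  simp only [smul_eq_mul, inner_smul_right, real_inner_comm x p]
  congr 2
  push_cast
  field_simp

/-- The Hardy inequalities for `ψ` with constant `C`:
`|ψ(x)| ≤ C e^(-A x·x/2)` and `|Fψ(p)| ≤ C e^(-B p·p/2)`, almost everywhere. -/
def HardyBounds {n : ℕ} (A B : Matrix (Fin n) (Fin n) ℝ) (C : ℝ) (ψ : L2Space n) : Prop :=
  (∀ᵐ x : EucSpace n, ‖ψ x‖ ≤ C * Real.exp (-(1 / 2) * quadForm A x)) ∧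
  (∀ᵐ p : EucSpace n, ‖unitaryFourier ψ p‖ ≤ C * Real.exp (-(1 / 2) * quadForm B p))

/-! Since the polar of the ellipsoid of `A` is that of `A⁻¹`, the dual pair condition reads `B ≤
A⁻¹` as quadratic forms. The Gaussian of `A` has transform proportional to the Gaussian of `A⁻¹`, so
it satisfies the inequalities when `B ≤ A⁻¹`.

For the converse, the bound on `ψ` makes its transform entire on each complex line `q + z p`, with
growth `exp(a (Im z)² / 2)`, `a = A⁻¹p·p`. By one-variable Hardy (`hardy_entire`), decay `exp(-a s²
/ 2)` on the real line forces a multiple of that Gaussian. If `B = A⁻¹`, lines through the origin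
show that the transform is Gaussian, hence `ψ` is (`HardyBounds.exists_gaussianFun`). If `Bp·p >
A⁻¹p·p` for some `p`, the transform decays faster than the Gaussian it must be on every line of
direction `p`, so it vanishes (`fourierLine_eq_zero`). Working line by line avoids diagonalising `A`
and `B` together.

In (ii), if `B ≤ A⁻¹` then the Gaussian of `B⁻¹` also satisfies the inequalities; uniqueness forces
`B⁻¹ = A`. -/

/-! ### Phragmén–Lindelöf and Hardy's theorem in one complex variable -/

/-- The Phragmén–Lindelöf estimate in the sector `0 ≤ arg z ≤ θ` with `θ < π / 2`. -/
theorem norm_le_of_sector {F : ℂ → ℂ} (hF : Differentiable ℂ F) {a C θ : ℝ} (ha : 0 ≤ a)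
    (hb : ∀ z : ℂ, ‖F z‖ ≤ C * Real.exp (a / 2 * z.re ^ 2)) (hr : ∀ s : ℝ, ‖F s‖ ≤ C)
    (hθ : 0 < θ) (hθ' : θ < Real.pi / 2) {z : ℂ} (hz : z ≠ 0) (hz0 : 0 ≤ z.arg)
    (hz1 : z.arg ≤ θ) :
    ‖F z‖ ≤ C * Real.exp (2 * (a * Real.cos θ / (4 * Real.sin θ)) * (z.re * z.im)) := by
  have hC : 0 ≤ C := (norm_nonneg _).trans (hr 0)
  have hs : 0 < Real.sin θ := Real.sin_pos_of_pos_of_lt_pi hθ (by linarith [Real.pi_pos])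
  have hc : 0 < Real.cos θ := Real.cos_pos_of_mem_Ioo ⟨by linarith [Real.pi_pos], hθ'⟩
  -- The factor `exp(iβz²)` has modulus 1 on the real axis; this `β` makes it cancel the growth
  -- `exp(a (Re z)² / 2)` exactly on the ray `arg z = θ`.
  set β : ℝ := a * Real.cos θ / (4 * Real.sin θ) with hβ
  have hβ0 : 0 ≤ β := by positivity
  have hnorm : ∀ u : ℂ, ‖Complex.exp (Complex.I * β * u ^ 2)‖
      = Real.exp (-(2 * β * (u.re * u.im))) := by
    intro u
    rw [Complex.norm_exp]
    congr 1
    simp [pow_two]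
    ring
  -- The substitution `z = exp w` turns the sector into the strip `0 ≤ Im w ≤ θ`.
  set G : ℂ → ℂ := fun w => F (Complex.exp w) * Complex.exp (Complex.I * β * (Complex.exp w) ^ 2)
    with hG
  have hGn : ∀ w, ‖G w‖ = ‖F (Complex.exp w)‖ *
      Real.exp (-(2 * β * ((Complex.exp w).re * (Complex.exp w).im))) := by
    intro w
    rw [hG, norm_mul, hnorm]
  have hGd : Differentiable ℂ G := by
    refine (hF.comp Complex.differentiable_exp).mul ?_
    fun_prop
  have hG_strip : ‖G (Complex.log z)‖ ≤ C := by
    refine PhragmenLindelof.horizontal_strip (a := 0) (b := θ) hGd.diffContOnCl ?_ ?_ ?_ ?_ ?_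
    -- Order 2 growth is admissible when `2 < π / θ`, that is, `θ < π / 2`.
    · refine ⟨2, ?_, a / 2, ?_⟩
      · rw [sub_zero, lt_div_iff₀ hθ]
        linarith
      · refine Asymptotics.IsBigO.of_bound C (Filter.mem_inf_of_right ?_)
        intro w hw
        have hw' : 0 < w.im ∧ w.im < θ := hw
        have h1 : 0 ≤ (Complex.exp w).re := by
          rw [Complex.exp_re]
          exact mul_nonneg (Real.exp_pos _).le
            (Real.cos_nonneg_of_mem_Icc ⟨by linarith [Real.pi_pos], by linarith⟩)
        have h2 : 0 ≤ (Complex.exp w).im := by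
          rw [Complex.exp_im]
          exact mul_nonneg (Real.exp_pos _).le
            (Real.sin_nonneg_of_nonneg_of_le_pi hw'.1.le (by linarith [Real.pi_pos]))
        have h3 : (Complex.exp w).re ^ 2 ≤ Real.exp (2 * |w.re|) := by
          have h4 : (Complex.exp w).re ≤ Real.exp |w.re| := by
            refine (Complex.re_le_norm _).trans ?_
            rw [Complex.norm_exp]
            exact Real.exp_le_exp.2 (le_abs_self _)
          calc (Complex.exp w).re ^ 2 ≤ (Real.exp |w.re|) ^ 2 := by gcongr
            _ = Real.exp (2 * |w.re|) := by rw [← Real.exp_nat_mul]; norm_num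
        change ‖G w‖ ≤ _
        rw [hGn, Real.norm_eq_abs, Real.abs_exp]
        calc _ ≤ C * Real.exp (a / 2 * (Complex.exp w).re ^ 2) * 1 := by
              gcongr
              · exact hb _
              · rw [Real.exp_le_one_iff]
                have := mul_nonneg hβ0 (mul_nonneg h1 h2)
                linarith
          _ ≤ _ := by
              rw [mul_one]
              gcongr
    · intro w hw
      rw [hGn]
      have h1 : Complex.exp w = ((Real.exp w.re : ℝ) : ℂ) := by
        rw [Complex.ofReal_exp]
        congr 1
        apply Complex.ext <;> simp [hw]
      rw [h1]
      simpa using hr (Real.exp w.re)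
    · intro w hw
      rw [hGn]
      have h1 := hb (Complex.exp w)
      have h2 : 2 * β * ((Complex.exp w).re * (Complex.exp w).im)
          = a / 2 * (Complex.exp w).re ^ 2 := by
        rw [Complex.exp_re, Complex.exp_im, hw, hβ]
        field_simp
        ring
      rw [h2]
      calc _ ≤ C * Real.exp (a / 2 * (Complex.exp w).re ^ 2) *
            Real.exp (-(a / 2 * (Complex.exp w).re ^ 2)) := by gcongr
        _ = C := by rw [mul_assoc, ← Real.exp_add]; simp
    · simpa [Complex.log_im] using hz0
    · simpa [Complex.log_im] using hz1
  rw [hGn, Complex.exp_log hz, Real.exp_neg, ← div_eq_mul_inv, div_le_iff₀ (Real.exp_pos _)]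
    at hG_strip
  exact hG_strip

/-- Order 2 is critical for a right angle, so the sector bound is used for `θ < π / 2`; as `θ → π /
2` its exponent tends to 0. On the imaginary axis the growth bound is already `C`. -/
theorem norm_le_of_quadrant {F : ℂ → ℂ} (hF : Differentiable ℂ F) {a C : ℝ} (ha : 0 ≤ a)
    (hb : ∀ z : ℂ, ‖F z‖ ≤ C * Real.exp (a / 2 * z.re ^ 2)) (hr : ∀ s : ℝ, ‖F s‖ ≤ C)
    {z : ℂ} (h0 : 0 ≤ z.re) (h1 : 0 ≤ z.im) : ‖F z‖ ≤ C := by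
  rcases h0.eq_or_lt with h | h0
  · simpa [← h] using hb z
  have hz : z ≠ 0 := by
    rintro rfl
    simp at h0
  have harg0 : 0 ≤ z.arg := Complex.arg_nonneg_iff.2 h1
  have harg1 : z.arg < Real.pi / 2 :=
    (abs_lt.1 (Complex.abs_arg_lt_pi_div_two_iff.2 (Or.inl h0))).2
  have hlim : Filter.Tendsto (fun θ : ℝ =>
      C * Real.exp (2 * (a * Real.cos θ / (4 * Real.sin θ)) * (z.re * z.im)))
      (nhdsWithin (Real.pi / 2) (Set.Iio (Real.pi / 2))) (nhds C) := by
    have hcont : ContinuousAt (fun θ : ℝ =>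
        C * Real.exp (2 * (a * Real.cos θ / (4 * Real.sin θ)) * (z.re * z.im)))
        (Real.pi / 2) := by
      have hne : 4 * Real.sin (Real.pi / 2) ≠ 0 := by simp
      fun_prop (disch := exact hne)
    have := hcont.tendsto
    simp only [Real.cos_pi_div_two, mul_zero, zero_div, zero_mul, Real.exp_zero, mul_one] at this
    exact this.mono_left nhdsWithin_le_nhds
  refine ge_of_tendsto hlim ?_
  filter_upwards [Ioo_mem_nhdsLT harg1] with θ hθ
  exact norm_le_of_sector hF ha hb hr (harg0.trans_lt hθ.1) hθ.2 hz harg0 hθ.1.le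

theorem norm_le_of_half_plane {F : ℂ → ℂ} (hF : Differentiable ℂ F) {a C : ℝ} (ha : 0 ≤ a)
    (hb : ∀ z : ℂ, ‖F z‖ ≤ C * Real.exp (a / 2 * z.re ^ 2)) (hr : ∀ s : ℝ, ‖F s‖ ≤ C)
    {z : ℂ} (h0 : 0 ≤ z.re) : ‖F z‖ ≤ C := by
  rcases le_total 0 z.im with h1 | h1
  · exact norm_le_of_quadrant hF ha hb hr h0 h1
  · have hd : Differentiable ℂ (fun w => (starRingEnd ℂ) (F ((starRingEnd ℂ) w))) := fun w =>
      differentiableAt_conj_conj_iff.2 (hF _)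
    have := norm_le_of_quadrant (F := fun w => (starRingEnd ℂ) (F ((starRingEnd ℂ) w))) hd ha
      (fun w => by simpa using hb ((starRingEnd ℂ) w)) (fun s => by simpa using hr s)
      (z := (starRingEnd ℂ) z) (by simpa using h0) (by simpa using h1)
    simpa using this

/-- An entire function dominated by a Gaussian growth in `Re z` alone and bounded on the real axis
is bounded. -/
theorem norm_le_of_real_axis {F : ℂ → ℂ} (hF : Differentiable ℂ F) {a C : ℝ} (ha : 0 ≤ a)
    (hb : ∀ z : ℂ, ‖F z‖ ≤ C * Real.exp (a / 2 * z.re ^ 2)) (hr : ∀ s : ℝ, ‖F s‖ ≤ C)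
    (z : ℂ) : ‖F z‖ ≤ C := by
  rcases le_total 0 z.re with h0 | h0
  · exact norm_le_of_half_plane hF ha hb hr h0
  · have := norm_le_of_half_plane (F := fun w => F (-w)) (hF.comp differentiable_neg) ha
      (fun w => by simpa using hb (-w)) (fun s => by simpa using hr (-s))
      (z := -z) (by simpa using h0)
    simpa using this

/-- The complex-analytic core of Hardy's theorem in one variable. -/
theorem hardy_entire {h : ℂ → ℂ} (hd : Differentiable ℂ h) {a C : ℝ} (ha : 0 ≤ a)
    (hb : ∀ z : ℂ, ‖h z‖ ≤ C * Real.exp (a / 2 * z.im ^ 2))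
    (hr : ∀ s : ℝ, ‖h s‖ ≤ C * Real.exp (-(a / 2) * s ^ 2)) (z : ℂ) :
    h z = h 0 * Complex.exp (-(a / 2) * z ^ 2) := by
  have hn : ∀ z : ℂ, ‖Complex.exp (a / 2 * z ^ 2)‖
      = Real.exp (a / 2 * z.re ^ 2 - a / 2 * z.im ^ 2) := by
    intro z
    have e : ((a : ℂ) / 2) = ((a / 2 : ℝ) : ℂ) := by push_cast; ring
    rw [Complex.norm_exp, e, Complex.re_ofReal_mul]
    congr 1
    simp [pow_two]
    ring
  -- This factor trades growth in `Im z` for growth in `Re z`, and decay on the real axis for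
  -- boundedness there. Then `F` is bounded, hence constant by Liouville.
  set F : ℂ → ℂ := fun z => h z * Complex.exp (a / 2 * z ^ 2) with hFdef
  have hF : Differentiable ℂ F := by
    refine hd.mul ?_
    fun_prop
  have hFb : ∀ z, ‖F z‖ ≤ C := by
    refine norm_le_of_real_axis hF ha (fun z => ?_) (fun s => ?_)
    · rw [hFdef, norm_mul, hn]
      calc _ ≤ C * Real.exp (a / 2 * z.im ^ 2) *
            Real.exp (a / 2 * z.re ^ 2 - a / 2 * z.im ^ 2) := by
              gcongr
              exact hb z
        _ = _ := by
          rw [mul_assoc, ← Real.exp_add]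
          congr 2
          ring
    · rw [hFdef, norm_mul, hn]
      calc _ ≤ C * Real.exp (-(a / 2) * s ^ 2) *
            Real.exp (a / 2 * (s : ℂ).re ^ 2 - a / 2 * (s : ℂ).im ^ 2) := by
              gcongr
              exact hr s
        _ = _ := by
          rw [mul_assoc, ← Real.exp_add]
          simp
  have hconst : F z = F 0 := hF.apply_eq_apply_of_bounded
    (isBounded_iff_forall_norm_le.2 ⟨C, by rintro _ ⟨w, rfl⟩; exact hFb w⟩) z 0
  have h0 : F 0 = h 0 := by simp [hFdef]
  rw [← h0, ← hconst, hFdef]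
  simp only
  rw [mul_assoc, ← Complex.exp_add]
  ring_nf
  simp

/-! ### Quadratic forms, ellipsoids and polarity -/

section QuadraticForms

variable {n : ℕ} {A B : Matrix (Fin n) (Fin n) ℝ}

theorem quadForm_eq_inner (A : Matrix (Fin n) (Fin n) ℝ) (x : EucSpace n) :
    quadForm A x = inner ℝ x (A.toEuclideanLin x) := by
  simp [quadForm, EuclideanSpace.inner_eq_star_dotProduct]

theorem inner_toEuclideanLin_comm (hA : A.PosDef) (x y : EucSpace n) :
    inner ℝ x (A.toEuclideanLin y) = inner ℝ y (A.toEuclideanLin x) := by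
  rw [real_inner_comm]
  exact (Matrix.isSymmetric_toEuclideanLin_iff.2 hA.isHermitian) y x

theorem quadForm_add (hA : A.PosDef) (x y : EucSpace n) :
    quadForm A (x + y) = quadForm A x + 2 * inner ℝ x (A.toEuclideanLin y) + quadForm A y := by
  simp only [quadForm_eq_inner, map_add, inner_add_left, inner_add_right]
  rw [inner_toEuclideanLin_comm hA y x]
  ring

theorem quadForm_smul (A : Matrix (Fin n) (Fin n) ℝ) (r : ℝ) (x : EucSpace n) :
    quadForm A (r • x) = r ^ 2 * quadForm A x := by
  simp only [quadForm_eq_inner, map_smul, inner_smul_left, inner_smul_right]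
  simp
  ring

theorem quadForm_neg (A : Matrix (Fin n) (Fin n) ℝ) (x : EucSpace n) :
    quadForm A (-x) = quadForm A x := by
  simpa using quadForm_smul A (-1) x

theorem quadForm_zero (A : Matrix (Fin n) (Fin n) ℝ) : quadForm A 0 = 0 := by
  simp [quadForm_eq_inner]

theorem quadForm_pos (hA : A.PosDef) {x : EucSpace n} (hx : x ≠ 0) : 0 < quadForm A x := by
  have := hA.dotProduct_mulVec_pos (x := x.ofLp) (by simpa using hx)
  simpa [quadForm, dotProduct_comm] using this

theorem quadForm_nonneg (hA : A.PosDef) (x : EucSpace n) : 0 ≤ quadForm A x := by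
  rcases eq_or_ne x 0 with rfl | hx
  · rw [quadForm_zero]
  · exact (quadForm_pos hA hx).le

theorem continuous_quadForm (A : Matrix (Fin n) (Fin n) ℝ) : Continuous (quadForm A) := by
  have : quadForm A = fun x => inner ℝ x (A.toEuclideanLin x) := funext (quadForm_eq_inner A)
  rw [this]
  exact continuous_id.inner (LinearMap.continuous_of_finiteDimensional _)

theorem toEuclideanLin_inv_apply (hA : A.PosDef) (x : EucSpace n) :
    A.toEuclideanLin (A⁻¹.toEuclideanLin x) = x := by
  have hu : IsUnit A.det := (Matrix.isUnit_iff_isUnit_det _).1 hA.isUnit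
  simp [Matrix.toLpLin_apply, Matrix.mul_nonsing_inv _ hu]

theorem quadForm_toEuclideanLin_inv (hA : A.PosDef) (x : EucSpace n) :
    quadForm A (A⁻¹.toEuclideanLin x) = quadForm A⁻¹ x := by
  rw [quadForm_eq_inner, toEuclideanLin_inv_apply hA, quadForm_eq_inner, real_inner_comm]

/-- Completing the square. -/
theorem quadForm_sub_toEuclideanLin_inv (hA : A.PosDef) (x p : EucSpace n) :
    quadForm A (x - A⁻¹.toEuclideanLin p)
      = quadForm A x - 2 * inner ℝ p x + quadForm A⁻¹ p := by
  rw [sub_eq_add_neg, quadForm_add hA, quadForm_neg, quadForm_toEuclideanLin_inv hA, map_neg,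
    toEuclideanLin_inv_apply hA, inner_neg_right, real_inner_comm]
  ring

theorem inv_inv_of_posDef (hA : A.PosDef) : A⁻¹⁻¹ = A :=
  Matrix.nonsing_inv_nonsing_inv _ ((Matrix.isUnit_iff_isUnit_det _).1 hA.isUnit)

/-- Inversion reverses the order of quadratic forms. -/
theorem quadForm_le_inv (hA : A.PosDef) (hB : B.PosDef)
    (h : ∀ p : EucSpace n, quadForm B p ≤ quadForm A⁻¹ p) (x : EucSpace n) :
    quadForm A x ≤ quadForm B⁻¹ x := by
  -- Expanded, this is `0 ≤ B(Ax)·Ax - 2 Ax·x + B⁻¹x·x`, and the first term is at most `A⁻¹(Ax)·Ax =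
  -- Ax·x`.
  have h1 := quadForm_nonneg hB (A.toEuclideanLin x - B⁻¹.toEuclideanLin x)
  rw [quadForm_sub_toEuclideanLin_inv hB, ← quadForm_eq_inner] at h1
  have h2 := h (A.toEuclideanLin x)
  have h3 := quadForm_toEuclideanLin_inv hA.inv x
  rw [inv_inv_of_posDef hA] at h3
  linarith

/-- Positivity at `x - t A⁻¹x` gives `2t‖x‖² ≤ Ax·x + t² A⁻¹x·x`; for `t‖A⁻¹‖ ≤ 1` the last term is
at most `t‖x‖²`, so `m = t` works. -/
theorem exists_mul_norm_sq_le_quadForm (hA : A.PosDef) :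
    ∃ m : ℝ, 0 < m ∧ ∀ x : EucSpace n, m * ‖x‖ ^ 2 ≤ quadForm A x := by
  set S := LinearMap.toContinuousLinearMap (A⁻¹.toEuclideanLin) with hS
  set t : ℝ := 1 / (‖S‖ + 1) with ht
  have hS0 := norm_nonneg S
  have ht0 : 0 < t := by positivity
  refine ⟨t, ht0, fun x => ?_⟩
  have h1 := quadForm_nonneg hA (x - A⁻¹.toEuclideanLin (t • x))
  rw [quadForm_sub_toEuclideanLin_inv hA, quadForm_smul, inner_smul_left,
    real_inner_self_eq_norm_sq] at h1
  have h2 : quadForm A⁻¹ x ≤ ‖S‖ * ‖x‖ ^ 2 := by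
    rw [quadForm_eq_inner]
    calc inner ℝ x (S x) ≤ ‖x‖ * ‖S x‖ := real_inner_le_norm _ _
      _ ≤ ‖x‖ * (‖S‖ * ‖x‖) := by gcongr; exact S.le_opNorm x
      _ = _ := by ring
  have h3 : t * ‖S‖ ≤ 1 := by
    rw [ht, one_div, inv_mul_le_iff₀ (by positivity)]
    linarith
  have h4 : t ^ 2 * quadForm A⁻¹ x ≤ t * ‖x‖ ^ 2 :=
    calc t ^ 2 * quadForm A⁻¹ x ≤ t ^ 2 * (‖S‖ * ‖x‖ ^ 2) := by gcongr
      _ = (t * ‖S‖) * (t * ‖x‖ ^ 2) := by ring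
      _ ≤ 1 * (t * ‖x‖ ^ 2) := by gcongr
      _ = _ := one_mul _
  simp only [conj_trivial] at h1
  linarith

theorem isSymmConvexBody_ellipsoid (hA : A.PosDef) : IsSymmConvexBody (ellipsoid A) where
  convex := by
    intro x hx y hy s t hs ht hst
    have hx' : quadForm A x ≤ 1 := hx
    have hy' : quadForm A y ≤ 1 := hy
    change quadForm A (s • x + t • y) ≤ 1
    -- The convexity defect of the form is `s(1 - s)` times its value at `x - y`.
    have h := quadForm_nonneg hA (x + -y)
    rw [quadForm_add hA, quadForm_neg, map_neg, inner_neg_right] at h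
    rw [quadForm_add hA, quadForm_smul, quadForm_smul, map_smul, inner_smul_left,
      inner_smul_right]
    simp only [conj_trivial]
    obtain rfl : t = 1 - s := by linarith
    nlinarith [mul_nonneg hs ht]
  isCompact := by
    obtain ⟨m, hm, h⟩ := exists_mul_norm_sq_le_quadForm hA
    refine Metric.isCompact_of_isClosed_isBounded
      (isClosed_le (continuous_quadForm A) continuous_const) ?_
    refine isBounded_iff_forall_norm_le.2 ⟨Real.sqrt (1 / m), fun x hx => ?_⟩
    refine Real.le_sqrt_of_sq_le ?_
    rw [le_div_iff₀ hm, mul_comm]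
    exact (h x).trans hx
  nonempty_interior := by
    refine ⟨0, interior_maximal (s := ellipsoid A) (t := {x | quadForm A x < 1})
      (fun x hx => le_of_lt (show quadForm A x < 1 from hx))
      (isOpen_lt (continuous_quadForm A) continuous_const) ?_⟩
    simp [quadForm_zero]
  symm x := by simp [ellipsoid, quadForm_neg]

theorem ellipsoid_subset_iff (hA : A.PosDef) :
    ellipsoid A ⊆ ellipsoid B ↔ ∀ x : EucSpace n, quadForm B x ≤ quadForm A x := by
  refine ⟨fun h x => ?_, fun h x hx => (h x).trans hx⟩
  rcases eq_or_ne x 0 with rfl | hx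
  · simp [quadForm_zero]
  have h0 := quadForm_pos hA hx
  have h1 : (Real.sqrt (quadForm A x))⁻¹ • x ∈ ellipsoid A := by
    change quadForm A _ ≤ 1
    rw [quadForm_smul, inv_pow, Real.sq_sqrt h0.le, inv_mul_cancel₀ h0.ne']
  have h2 : quadForm B _ ≤ 1 := h h1
  rw [quadForm_smul, inv_pow, Real.sq_sqrt h0.le, inv_mul_le_iff₀ h0, mul_one] at h2
  exact h2

/-- One inclusion tests `p` on its maximiser `A⁻¹p / √(A⁻¹p·p)`; the other is `2 p·x ≤ Ax·x +
A⁻¹p·p`, from completing the square. -/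
theorem polarDual_ellipsoid (hA : A.PosDef) : polarDual (ellipsoid A) = ellipsoid A⁻¹ := by
  ext p
  constructor
  · intro hp
    change quadForm A⁻¹ p ≤ 1
    by_contra! h
    have h0 : 0 < quadForm A⁻¹ p := one_pos.trans h
    set r := Real.sqrt (quadForm A⁻¹ p) with hr
    have hr0 : 0 < r := Real.sqrt_pos.2 h0
    have hr2 : r ^ 2 = quadForm A⁻¹ p := Real.sq_sqrt h0.le
    have h1 := hp (r⁻¹ • A⁻¹.toEuclideanLin p) (by
      change quadForm A _ ≤ 1
      rw [quadForm_smul, quadForm_toEuclideanLin_inv hA, ← hr2, inv_pow,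
        inv_mul_cancel₀ (by positivity)])
    rw [inner_smul_right, ← quadForm_eq_inner, ← hr2, inv_mul_le_iff₀ hr0, mul_one] at h1
    nlinarith
  · intro hp x hx
    have hp' : quadForm A⁻¹ p ≤ 1 := hp
    have hx' : quadForm A x ≤ 1 := hx
    have h := quadForm_nonneg hA (x - A⁻¹.toEuclideanLin p)
    rw [quadForm_sub_toEuclideanLin_inv hA] at h
    linarith

theorem isDualPair_ellipsoid_iff (hA : A.PosDef) (hB : B.PosDef) :
    IsDualPair (ellipsoid A) (ellipsoid B) ↔
      ∀ p : EucSpace n, quadForm B p ≤ quadForm A⁻¹ p := by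
  rw [← ellipsoid_subset_iff hA.inv, ← polarDual_ellipsoid hA]
  exact ⟨fun h => h.polar_subset,
    fun h => ⟨isSymmConvexBody_ellipsoid hA, isSymmConvexBody_ellipsoid hB, h⟩⟩

theorem polarDual_ellipsoid_eq_iff (hA : A.PosDef) (hB : B.PosDef) :
    polarDual (ellipsoid A) = ellipsoid B ↔
      ∀ p : EucSpace n, quadForm B p = quadForm A⁻¹ p := by
  rw [polarDual_ellipsoid hA, Set.Subset.antisymm_iff, ellipsoid_subset_iff hA.inv,
    ellipsoid_subset_iff hB, ← forall_and]
  exact forall_congr' fun p => le_antisymm_iff.symm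

end QuadraticForms

/-! ### Gaussian integrals and the Fourier–Laplace transform on complex lines -/

section GaussianIntegrals

variable {n : ℕ} {A B : Matrix (Fin n) (Fin n) ℝ}

theorem integrable_exp_neg_quadForm (hA : A.PosDef) :
    Integrable fun x : EucSpace n => Real.exp (-(1 / 2) * quadForm A x) := by
  obtain ⟨m, hm, h⟩ := exists_mul_norm_sq_le_quadForm hA
  have h1 := (GaussianFourier.integrable_cexp_neg_mul_sq_norm_add (V := EucSpace n)
    (b := ((m / 2 : ℝ) : ℂ)) (by simpa using hm) 0 0).norm
  refine h1.mono' (by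
    have := continuous_quadForm A
    fun_prop) (.of_forall fun x => ?_)
  rw [Real.norm_eq_abs, Real.abs_exp, Complex.norm_exp, Real.exp_le_exp]
  have h2 : (-((m / 2 : ℝ) : ℂ) * (‖x‖ : ℂ) ^ 2 + 0 * (inner ℝ (0 : EucSpace n) x : ℝ)).re
      = -(m / 2) * ‖x‖ ^ 2 := by
    rw [zero_mul, add_zero]
    norm_cast
  rw [h2]
  linarith [h x]

theorem exp_neg_quadForm_add_inner (hA : A.PosDef) (v x : EucSpace n) :
    Real.exp (-(1 / 2) * quadForm A x + inner ℝ v x) = Real.exp (1 / 2 * quadForm A⁻¹ v) *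
      Real.exp (-(1 / 2) * quadForm A (x - A⁻¹.toEuclideanLin v)) := by
  rw [quadForm_sub_toEuclideanLin_inv hA, ← Real.exp_add]
  congr 1
  ring

theorem integrable_exp_neg_quadForm_add_inner (hA : A.PosDef) (v : EucSpace n) :
    Integrable fun x : EucSpace n => Real.exp (-(1 / 2) * quadForm A x + inner ℝ v x) := by
  simp_rw [exp_neg_quadForm_add_inner hA v]
  exact ((integrable_exp_neg_quadForm hA).comp_sub_right _).const_mul _

theorem integral_exp_neg_quadForm_add_inner (hA : A.PosDef) (v : EucSpace n) :
    ∫ x : EucSpace n, Real.exp (-(1 / 2) * quadForm A x + inner ℝ v x) =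
      Real.exp (1 / 2 * quadForm A⁻¹ v) *
        ∫ x : EucSpace n, Real.exp (-(1 / 2) * quadForm A x) := by
  simp_rw [exp_neg_quadForm_add_inner hA v]
  rw [integral_const_mul, integral_sub_right_eq_self
    (fun x : EucSpace n => Real.exp (-(1 / 2) * quadForm A x))]

theorem integral_exp_neg_quadForm_pos (hA : A.PosDef) :
    0 < ∫ x : EucSpace n, Real.exp (-(1 / 2) * quadForm A x) :=
  integral_exp_pos (integrable_exp_neg_quadForm hA)

/-- The Fourier–Laplace transform of `f` along the complex line `z ↦ q + z p`. -/
noncomputable def fourierLine (f : EucSpace n → ℂ) (q p : EucSpace n) (z : ℂ) : ℂ :=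
  ∫ x : EucSpace n,
    Complex.exp (-(Complex.I * ((inner ℝ q x : ℝ) + z * (inner ℝ p x : ℝ)))) * f x

theorem norm_exp_fourierLine (q p x : EucSpace n) (z : ℂ) :
    ‖Complex.exp (-(Complex.I * ((inner ℝ q x : ℝ) + z * (inner ℝ p x : ℝ))))‖
      = Real.exp (inner ℝ (z.im • p) x) := by
  rw [Complex.norm_exp, inner_smul_left]
  simp

theorem continuous_exp_fourierLine (q p : EucSpace n) (z : ℂ) : Continuous fun x : EucSpace n =>
    Complex.exp (-(Complex.I * ((inner ℝ q x : ℝ) + z * (inner ℝ p x : ℝ)))) := by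
  fun_prop

variable {f : EucSpace n → ℂ} {C : ℝ}

/-- The kernel has modulus `exp(Im z p·x)`, free of `q` and `Re z`; completing the square evaluates
the integral. -/
theorem norm_fourierLine_le (hA : A.PosDef)
    (hb : ∀ᵐ x : EucSpace n, ‖f x‖ ≤ C * Real.exp (-(1 / 2) * quadForm A x))
    (q p : EucSpace n) (z : ℂ) :
    ‖fourierLine f q p z‖ ≤ C * (∫ x : EucSpace n, Real.exp (-(1 / 2) * quadForm A x)) *
      Real.exp (quadForm A⁻¹ p / 2 * z.im ^ 2) := by
  have h1 : ‖fourierLine f q p z‖ ≤ ∫ x : EucSpace n, C *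
      Real.exp (-(1 / 2) * quadForm A x + inner ℝ (z.im • p) x) := by
    refine norm_integral_le_of_norm_le
      ((integrable_exp_neg_quadForm_add_inner hA (z.im • p)).const_mul C) ?_
    filter_upwards [hb] with x hx
    rw [norm_mul, norm_exp_fourierLine, Real.exp_add, ← mul_assoc, mul_comm]
    gcongr
  refine h1.trans_eq ?_
  rw [integral_const_mul, integral_exp_neg_quadForm_add_inner hA, quadForm_smul]
  ring_nf

theorem integrable_fourierLine (hA : A.PosDef) (hf : AEStronglyMeasurable f)
    (hb : ∀ᵐ x : EucSpace n, ‖f x‖ ≤ C * Real.exp (-(1 / 2) * quadForm A x))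
    (q p : EucSpace n) (z : ℂ) : Integrable fun x : EucSpace n =>
      Complex.exp (-(Complex.I * ((inner ℝ q x : ℝ) + z * (inner ℝ p x : ℝ)))) * f x := by
  refine ((integrable_exp_neg_quadForm_add_inner hA (z.im • p)).const_mul C).mono'
    ((continuous_exp_fourierLine q p z).aestronglyMeasurable.mul hf) ?_
  filter_upwards [hb] with x hx
  rw [norm_mul, norm_exp_fourierLine, Real.exp_add, ← mul_assoc, mul_comm]
  gcongr

theorem differentiable_fourierLine (hA : A.PosDef) (hf : AEStronglyMeasurable f)
    (hb : ∀ᵐ x : EucSpace n, ‖f x‖ ≤ C * Real.exp (-(1 / 2) * quadForm A x))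
    (q p : EucSpace n) : Differentiable ℂ (fourierLine f q p) := by
  intro z₀
  -- One extra unit covers `z` in the unit ball around `z₀`, the other absorbs the factor `|p·x|`
  -- from the derivative. The exponentials with `R` and `-R` cover both signs of `p·x`.
  set R : ℝ := |z₀.im| + 2 with hR
  have hbound : Integrable fun x : EucSpace n =>
      C * Real.exp (-(1 / 2) * quadForm A x + inner ℝ (R • p) x) +
      C * Real.exp (-(1 / 2) * quadForm A x + inner ℝ ((-R) • p) x) :=
    ((integrable_exp_neg_quadForm_add_inner hA (R • p)).const_mul C).add
      ((integrable_exp_neg_quadForm_add_inner hA ((-R) • p)).const_mul C)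
  refine (hasDerivAt_integral_of_dominated_loc_of_deriv_le (Metric.ball_mem_nhds z₀ one_pos)
    (F := fun z x =>
      Complex.exp (-(Complex.I * ((inner ℝ q x : ℝ) + z * (inner ℝ p x : ℝ)))) * f x)
    (F' := fun z x => (Complex.exp (-(Complex.I * ((inner ℝ q x : ℝ) + z * (inner ℝ p x : ℝ))))
      * (-(Complex.I * (inner ℝ p x : ℝ)))) * f x)
    (.of_forall fun z => (continuous_exp_fourierLine q p z).aestronglyMeasurable.mul hf)
    (integrable_fourierLine hA hf hb q p z₀) ?_ ?_ hbound ?_).2.differentiableAt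
  · refine AEStronglyMeasurable.mul (Continuous.aestronglyMeasurable ?_) hf
    fun_prop
  · filter_upwards [hb] with x hx z hz
    have hCexp : 0 ≤ C * Real.exp (-(1 / 2) * quadForm A x) := (norm_nonneg _).trans hx
    have him : |z.im| ≤ |z₀.im| + 1 := by
      have h1 : |(z - z₀).im| ≤ 1 :=
        (Complex.abs_im_le_norm _).trans (le_of_lt (by simpa [dist_eq_norm] using hz))
      rw [Complex.sub_im] at h1
      linarith [abs_sub_abs_le_abs_sub z.im z₀.im]
    set s : ℝ := inner ℝ p x with hs
    have h2 : Real.exp (z.im * s) * |s| ≤ Real.exp (R * s) + Real.exp (-R * s) := by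
      have h3 : Real.exp (z.im * s) * |s| ≤ Real.exp (R * |s|) := by
        have h4 : |s| ≤ Real.exp |s| := by linarith [Real.add_one_le_exp |s|]
        calc Real.exp (z.im * s) * |s| ≤ Real.exp ((|z₀.im| + 1) * |s|) * Real.exp |s| := by
              refine mul_le_mul (Real.exp_le_exp.2 ?_) h4 (abs_nonneg _) (Real.exp_pos _).le
              calc z.im * s ≤ |z.im * s| := le_abs_self _
                _ = |z.im| * |s| := abs_mul _ _
                _ ≤ _ := by gcongr
          _ = _ := by rw [← Real.exp_add, hR]; ring_nf
      rcases abs_choice s with h | h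
      · rw [h] at h3 ⊢
        linarith [Real.exp_pos (-R * s)]
      · rw [h] at h3 ⊢
        have : R * -s = -R * s := by ring
        rw [this] at h3
        linarith [Real.exp_pos (R * s)]
    have h5 : ‖-(Complex.I * (s : ℂ))‖ = |s| := by simp
    rw [norm_mul, norm_mul, norm_exp_fourierLine, h5, inner_smul_left, inner_smul_left,
      inner_smul_left, Real.exp_add, Real.exp_add]
    simp only [conj_trivial]
    calc _ ≤ (Real.exp (R * s) + Real.exp (-R * s)) *
          (C * Real.exp (-(1 / 2) * quadForm A x)) := by gcongr
      _ = _ := by ring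
  · refine .of_forall fun x z _ => HasDerivAt.mul_const ?_ _
    have h1 : HasDerivAt (fun z : ℂ =>
        -(Complex.I * ((inner ℝ q x : ℝ) + z * (inner ℝ p x : ℝ))))
        (-(Complex.I * (inner ℝ p x : ℝ))) z := by
      have := (((hasDerivAt_id z).mul_const ((inner ℝ p x : ℝ) : ℂ)).const_add
        ((inner ℝ q x : ℝ) : ℂ)).const_mul Complex.I |>.neg
      simpa [Pi.neg_def] using this
    exact h1.cexp

/-- Thus `fourierLine f q 0 0` serves as the unnormalised Fourier integral at the real frequency
`q`. -/
theorem fourierLine_ofReal (f : EucSpace n → ℂ) (q p : EucSpace n) (s : ℝ) :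
    fourierLine f q p s = fourierLine f (q + s • p) 0 0 := by
  simp [fourierLine, inner_add_left, inner_smul_left]

theorem continuous_fourierLine_left (hA : A.PosDef) (hf : AEStronglyMeasurable f)
    (hb : ∀ᵐ x : EucSpace n, ‖f x‖ ≤ C * Real.exp (-(1 / 2) * quadForm A x)) :
    Continuous fun q : EucSpace n => fourierLine f q 0 0 := by
  refine continuous_of_dominated (bound := fun x => C * Real.exp (-(1 / 2) * quadForm A x))
    (fun q => (continuous_exp_fourierLine q 0 0).aestronglyMeasurable.mul hf) (fun q => ?_)
    ((integrable_exp_neg_quadForm hA).const_mul C) (.of_forall fun x => ?_)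
  · filter_upwards [hb] with x hx
    rw [norm_mul, norm_exp_fourierLine]
    simpa using hx
  · fun_prop

/-- The Fourier transform of a Gaussian. -/
theorem fourierLine_gaussian (hA : A.PosDef) (p : EucSpace n) :
    fourierLine (fun x => (Real.exp (-(1 / 2) * quadForm A x) : ℂ)) p 0 0 =
      (∫ x : EucSpace n, Real.exp (-(1 / 2) * quadForm A x) : ℝ) *
        (Real.exp (-(1 / 2) * quadForm A⁻¹ p) : ℂ) := by
  set f : EucSpace n → ℂ := fun x => (Real.exp (-(1 / 2) * quadForm A x) : ℂ) with hf
  set K : ℝ := ∫ x : EucSpace n, Real.exp (-(1 / 2) * quadForm A x) with hK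
  have hfm : AEStronglyMeasurable f := by
    have := continuous_quadForm A
    refine Continuous.aestronglyMeasurable ?_
    fun_prop
  have hfb : ∀ᵐ x : EucSpace n, ‖f x‖ ≤ 1 * Real.exp (-(1 / 2) * quadForm A x) :=
    .of_forall fun x => by
      rw [hf, one_mul, Complex.norm_real, Real.norm_eq_abs, Real.abs_exp]
  have hd := differentiable_fourierLine hA hfm hfb 0 p
  -- On the imaginary axis the integral is a real Laplace transform, known explicitly; the identity
  -- theorem carries the formula to `z = 1`.
  have him : ∀ t : ℝ, fourierLine f 0 p (t * Complex.I) =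
      K * Complex.exp (-(quadForm A⁻¹ p / 2) * (t * Complex.I) ^ 2) := by
    intro t
    have h1 := integral_exp_neg_quadForm_add_inner hA (t • p)
    rw [← hK] at h1
    have h2 : fourierLine f 0 p (t * Complex.I) =
        ((∫ x : EucSpace n, Real.exp (-(1 / 2) * quadForm A x + inner ℝ (t • p) x) : ℝ) : ℂ) := by
      rw [← integral_complex_ofReal, fourierLine]
      congr 1
      ext x
      rw [hf]
      simp only [Complex.ofReal_exp]
      rw [← Complex.exp_add]
      congr 1
      rw [inner_smul_left]
      push_cast
      simp only [inner_zero_left, conj_trivial, Complex.ofReal_zero]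
      linear_combination (-(t : ℂ) * (inner ℝ p x : ℝ)) * Complex.I_sq
    rw [h2, h1, quadForm_smul]
    push_cast
    rw [mul_comm]
    congr 2
    linear_combination (quadForm A⁻¹ p / 2 * (t : ℂ) ^ 2) * Complex.I_sq
  have hd2 : Differentiable ℂ fun z : ℂ =>
      (K : ℂ) * Complex.exp (-(quadForm A⁻¹ p / 2) * z ^ 2) := by fun_prop
  have heq : fourierLine f 0 p = fun z : ℂ =>
      (K : ℂ) * Complex.exp (-(quadForm A⁻¹ p / 2) * z ^ 2) := by
    refine AnalyticOnNhd.eq_of_frequently_eq (z₀ := 0) (fun z _ => hd.analyticAt z)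
      (fun z _ => hd2.analyticAt z) ?_
    have ht : Filter.Tendsto (fun t : ℝ => (t : ℂ) * Complex.I) (nhdsWithin 0 {0}ᶜ)
        (nhdsWithin 0 {0}ᶜ) := by
      refine tendsto_nhdsWithin_iff.2 ⟨?_, ?_⟩
      · have hc : Continuous fun t : ℝ => (t : ℂ) * Complex.I := by fun_prop
        have := hc.tendsto 0
        simp only [Complex.ofReal_zero, zero_mul] at this
        exact this.mono_left nhdsWithin_le_nhds
      · filter_upwards [self_mem_nhdsWithin] with t ht
        simpa using ht
    exact ht.frequently (Filter.Frequently.of_forall him)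
  have h1 := congrFun heq ((1 : ℝ) : ℂ)
  rw [fourierLine_ofReal, zero_add, one_smul] at h1
  rw [h1]
  push_cast
  congr 2
  ring

end GaussianIntegrals

/-! ### Hardy's theorem in several variables -/

section Hardy

variable {n : ℕ} {A B M : Matrix (Fin n) (Fin n) ℝ} {f : EucSpace n → ℂ} {C D : ℝ}

/-- Hardy's theorem along a real line. -/
theorem fourierLine_line_eq (hA : A.PosDef) (hf : AEStronglyMeasurable f)
    (hb : ∀ᵐ x : EucSpace n, ‖f x‖ ≤ C * Real.exp (-(1 / 2) * quadForm A x)) (q p : EucSpace n)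
    (hD : ∀ s : ℝ, ‖fourierLine f (q + s • p) 0 0‖
      ≤ D * Real.exp (-(quadForm A⁻¹ p / 2) * s ^ 2)) (s : ℝ) :
    fourierLine f (q + s • p) 0 0 =
      fourierLine f q 0 0 * (Real.exp (-(quadForm A⁻¹ p / 2) * s ^ 2) : ℂ) := by
  set K : ℝ := ∫ x : EucSpace n, Real.exp (-(1 / 2) * quadForm A x) with hK
  have h := hardy_entire (differentiable_fourierLine hA hf hb q p)
    (a := quadForm A⁻¹ p) (C := max (C * K) D) (quadForm_nonneg hA.inv p)
    (fun z => (norm_fourierLine_le hA hb q p z).trans (by gcongr; exact le_max_left _ _))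
    (fun t => by
      rw [fourierLine_ofReal]
      exact (hD t).trans (by gcongr; exact le_max_right _ _)) s
  have h0 : fourierLine f q p 0 = fourierLine f q 0 0 := by simp [fourierLine]
  rw [fourierLine_ofReal, h0] at h
  rw [h]
  push_cast
  rfl

theorem fourierLine_eq_gaussian (hA : A.PosDef) (hf : AEStronglyMeasurable f)
    (hb : ∀ᵐ x : EucSpace n, ‖f x‖ ≤ C * Real.exp (-(1 / 2) * quadForm A x))
    (hD : ∀ p : EucSpace n, ‖fourierLine f p 0 0‖
      ≤ D * Real.exp (-(1 / 2) * quadForm A⁻¹ p)) (p : EucSpace n) :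
    fourierLine f p 0 0 =
      fourierLine f 0 0 0 * (Real.exp (-(1 / 2) * quadForm A⁻¹ p) : ℂ) := by
  have h := fourierLine_line_eq hA hf hb 0 p (D := D) (fun s => by
    refine (hD _).trans_eq ?_
    rw [zero_add, quadForm_smul]
    ring_nf) 1
  rw [zero_add, one_smul] at h
  rw [h]
  ring_nf

theorem fourierLine_eq_zero (hA : A.PosDef) (hB : B.PosDef) (hf : AEStronglyMeasurable f)
    (hb : ∀ᵐ x : EucSpace n, ‖f x‖ ≤ C * Real.exp (-(1 / 2) * quadForm A x))
    (hD : ∀ p : EucSpace n, ‖fourierLine f p 0 0‖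
      ≤ D * Real.exp (-(1 / 2) * quadForm B p)) {p : EucSpace n}
    (hp : quadForm A⁻¹ p < quadForm B p) (q : EucSpace n) : fourierLine f q 0 0 = 0 := by
  have hD0 : 0 ≤ D := by
    have := (norm_nonneg _).trans (hD 0)
    simpa [quadForm_zero] using this
  have hbp : 0 < quadForm B p := (quadForm_nonneg hA.inv p).trans_lt hp
  -- Then `q = r + s₀ p` with `r` orthogonal to `p` for `B`, so the form of `B` at `r + s p` is at
  -- least `s² Bp·p`.
  set s₀ : ℝ := inner ℝ q (B.toEuclideanLin p) / quadForm B p with hs₀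
  set r : EucSpace n := q - s₀ • p with hr
  have horth : inner ℝ r (B.toEuclideanLin p) = 0 := by
    rw [hr, inner_sub_left, inner_smul_left, ← quadForm_eq_inner, hs₀]
    simp only [conj_trivial]
    field_simp
    ring
  have hline : ∀ s : ℝ, ‖fourierLine f (r + s • p) 0 0‖
      ≤ D * Real.exp (-(quadForm B p / 2) * s ^ 2) := by
    intro s
    refine (hD _).trans ?_
    refine mul_le_mul_of_nonneg_left (Real.exp_le_exp.2 ?_) hD0
    rw [quadForm_add hB, map_smul, inner_smul_right, horth, quadForm_smul]
    linarith [quadForm_nonneg hB r]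
  have hline' := fourierLine_line_eq hA hf hb r p (D := D) (fun s => (hline s).trans (by gcongr))
  -- Dividing by the Gaussian of rate `A⁻¹p·p` leaves a bound that tends to 0 as `s → ∞`, while the
  -- left side is constant.
  have hle : ∀ s : ℝ, ‖fourierLine f r 0 0‖
      ≤ D * Real.exp (-((quadForm B p - quadForm A⁻¹ p) / 2 * s ^ 2)) := by
    intro s
    have h1 := hline s
    rw [hline' s, norm_mul, Complex.norm_real, Real.norm_eq_abs, Real.abs_exp,
      ← le_div_iff₀ (Real.exp_pos _), mul_div_assoc, ← Real.exp_sub] at h1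
    refine h1.trans_eq ?_
    congr 2
    ring
  have hlim : Filter.Tendsto (fun s : ℝ =>
      D * Real.exp (-((quadForm B p - quadForm A⁻¹ p) / 2 * s ^ 2))) Filter.atTop (nhds 0) := by
    rw [← mul_zero D]
    refine (Real.tendsto_exp_neg_atTop_nhds_zero.comp ?_).const_mul D
    exact (Filter.tendsto_pow_atTop two_ne_zero).const_mul_atTop (by linarith)
  have hzero : fourierLine f r 0 0 = 0 :=
    norm_le_zero_iff.1 (ge_of_tendsto hlim (.of_forall hle))
  have h1 := hline' s₀
  rwa [hzero, zero_mul, hr, sub_add_cancel] at h1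

/-- The normalising constant of the unitary Fourier transform. -/
noncomputable def fourierConst (n : ℕ) : ℝ := (1 / (2 * Real.pi)) ^ ((n : ℝ) / 2)

theorem fourierConst_pos (n : ℕ) : 0 < fourierConst n :=
  Real.rpow_pos_of_pos (by positivity) _

theorem unitaryFourier_ae_eq_fourierLine {ψ : L2Space n} (h : Integrable ψ) :
    ∀ᵐ p : EucSpace n, unitaryFourier ψ p = fourierConst n * fourierLine ψ p 0 0 := by
  filter_upwards [unitaryFourier_ae_eq ψ h] with p hp
  rw [hp, fourierConst, fourierLine]
  simp

theorem eq_of_unitaryFourier_ae_eq {ψ φ : L2Space n}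
    (h : ∀ᵐ p : EucSpace n, unitaryFourier ψ p = unitaryFourier φ p) : ψ = φ := by
  have hr : (2 * Real.pi) ≠ 0 := by positivity
  have hq := (Measure.quasiMeasurePreserving_smul (volume : Measure (EucSpace n)) hr).ae h
  have h1 : (𝓕 ψ : L2Space n) = 𝓕 φ := by
    refine Lp.ext ?_
    filter_upwards [hq] with p hp
    change unitaryFourier ψ ((2 * Real.pi) • p) = unitaryFourier φ ((2 * Real.pi) • p) at hp
    have hc : (((1 / (2 * Real.pi)) ^ ((n : ℝ) / 2) : ℝ) : ℂ) ≠ 0 :=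
      Complex.ofReal_ne_zero.2 (fourierConst_pos n).ne'
    simp only [unitaryFourier] at hp
    have hp' := mul_left_cancel₀ hc hp
    rwa [smul_smul, one_div, inv_mul_cancel₀ hr, one_smul] at hp'
  exact (Lp.fourierTransformₗᵢ (EucSpace n) ℂ).injective h1

theorem integrable_of_le_gaussian (hA : A.PosDef) (hf : AEStronglyMeasurable f)
    (hb : ∀ᵐ x : EucSpace n, ‖f x‖ ≤ C * Real.exp (-(1 / 2) * quadForm A x)) : Integrable f :=
  ((integrable_exp_neg_quadForm hA).const_mul C).mono' hf hb

/-- An almost everywhere bound may say nothing on a given line; continuity of the Fourier integral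
extends it from a dense set to every point. -/
theorem HardyBounds.norm_fourierLine_le {ψ : L2Space n} (hA : A.PosDef)
    (h : HardyBounds A B C ψ) (p : EucSpace n) :
    ‖fourierLine ψ p 0 0‖ ≤ C / fourierConst n * Real.exp (-(1 / 2) * quadForm B p) := by
  have hm : AEStronglyMeasurable (ψ : EucSpace n → ℂ) := Lp.aestronglyMeasurable ψ
  have hc := fourierConst_pos n
  have hae : ∀ᵐ p : EucSpace n, ‖fourierLine ψ p 0 0‖
      ≤ C / fourierConst n * Real.exp (-(1 / 2) * quadForm B p) := by
    filter_upwards [h.2, unitaryFourier_ae_eq_fourierLine (integrable_of_le_gaussian hA hm h.1)]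
      with p h1 h2
    rw [h2, norm_mul, Complex.norm_real, Real.norm_eq_abs, abs_of_pos hc] at h1
    rw [div_mul_eq_mul_div, le_div_iff₀ hc, mul_comm]
    exact h1
  have hB := continuous_quadForm B
  have hcl : IsClosed {p : EucSpace n | ‖fourierLine ψ p 0 0‖
      ≤ C / fourierConst n * Real.exp (-(1 / 2) * quadForm B p)} :=
    isClosed_le (continuous_fourierLine_left hA hm h.1).norm (by fun_prop)
  have := (Measure.dense_of_ae hae).closure_eq
  rw [hcl.closure_eq] at this
  exact Set.eq_univ_iff_forall.1 this p

/-- The Gaussian `c e^(-A x·x/2)`. -/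
noncomputable def gaussianFun (A : Matrix (Fin n) (Fin n) ℝ) (c : ℂ) (x : EucSpace n) : ℂ :=
  c * (Real.exp (-(1 / 2) * quadForm A x) : ℂ)

theorem continuous_gaussianFun (A : Matrix (Fin n) (Fin n) ℝ) (c : ℂ) :
    Continuous (gaussianFun A c) := by
  have := continuous_quadForm A
  unfold gaussianFun
  fun_prop

theorem norm_gaussianFun (A : Matrix (Fin n) (Fin n) ℝ) (c : ℂ) (x : EucSpace n) :
    ‖gaussianFun A c x‖ = ‖c‖ * Real.exp (-(1 / 2) * quadForm A x) := by
  rw [gaussianFun, norm_mul, Complex.norm_real, Real.norm_eq_abs, Real.abs_exp]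

theorem memLp_gaussianFun (hA : A.PosDef) (c : ℂ) :
    MemLp (gaussianFun A c) 2 (volume : Measure (EucSpace n)) := by
  rw [memLp_two_iff_integrable_sq_norm (continuous_gaussianFun A c).aestronglyMeasurable]
  refine ((integrable_exp_neg_quadForm hA).const_mul (‖c‖ ^ 2)).mono'
    ((continuous_gaussianFun A c).norm.pow 2).aestronglyMeasurable (.of_forall fun x => ?_)
  rw [norm_gaussianFun, Real.norm_eq_abs, abs_of_nonneg (by positivity), mul_pow,
    ← Real.exp_nat_mul]
  refine mul_le_mul_of_nonneg_left (Real.exp_le_exp.2 ?_) (by positivity)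
  have := quadForm_nonneg hA x
  push_cast
  linarith

theorem fourierLine_gaussianFun (hA : A.PosDef) (c : ℂ) (p : EucSpace n) :
    fourierLine (gaussianFun A c) p 0 0 =
      c * (∫ x : EucSpace n, Real.exp (-(1 / 2) * quadForm A x) : ℝ) *
        (Real.exp (-(1 / 2) * quadForm A⁻¹ p) : ℂ) := by
  rw [mul_assoc, ← fourierLine_gaussian hA, fourierLine, fourierLine, ← integral_const_mul]
  congr 1
  ext x
  rw [gaussianFun]
  ring

theorem fourierLine_congr {g : EucSpace n → ℂ} (h : f =ᵐ[volume] g) (q p : EucSpace n) (z : ℂ) :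
    fourierLine f q p z = fourierLine g q p z := by
  refine integral_congr_ae ?_
  filter_upwards [h] with x hx
  rw [hx]

theorem ae_eq_gaussianFun_of_fourierLine {ψ : L2Space n} (hA : A.PosDef) (hψ : Integrable ψ)
    {c : ℂ} (h : ∀ p : EucSpace n, fourierLine ψ p 0 0 =
      c * (∫ x : EucSpace n, Real.exp (-(1 / 2) * quadForm A x) : ℝ) *
        (Real.exp (-(1 / 2) * quadForm A⁻¹ p) : ℂ)) :
    ψ =ᵐ[volume] gaussianFun A c := by
  have hφ := (memLp_gaussianFun hA c).coeFn_toLp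
  set φ : L2Space n := (memLp_gaussianFun hA c).toLp with hφdef
  have hint : Integrable (gaussianFun A c) := integrable_of_le_gaussian hA
    (continuous_gaussianFun A c).aestronglyMeasurable
    (.of_forall fun x => (norm_gaussianFun A c x).le)
  have heq : ψ = φ := by
    refine eq_of_unitaryFourier_ae_eq ?_
    filter_upwards [unitaryFourier_ae_eq_fourierLine hψ,
      unitaryFourier_ae_eq_fourierLine (hint.congr hφ.symm)] with p h1 h2
    rw [h1, h2, h, fourierLine_congr hφ, fourierLine_gaussianFun hA]
  rw [heq]
  exact hφ

/-- Any `M` with `A ≤ M` and `B ≤ M⁻¹` is allowed, since both `M = A` and `M = B⁻¹` are needed. -/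
theorem exists_hardyBounds_gaussianFun {ψ : L2Space n} (hM : M.PosDef)
    (hAM : ∀ x : EucSpace n, quadForm A x ≤ quadForm M x)
    (hBM : ∀ p : EucSpace n, quadForm B p ≤ quadForm M⁻¹ p) {c : ℂ}
    (hψ : ψ =ᵐ[volume] gaussianFun M c) : ∃ C : ℝ, 0 < C ∧ HardyBounds A B C ψ := by
  have hint : Integrable (gaussianFun M c) := integrable_of_le_gaussian hM
    (continuous_gaussianFun M c).aestronglyMeasurable
    (.of_forall fun x => (norm_gaussianFun M c x).le)
  have hK := integral_exp_neg_quadForm_pos hM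
  set K : ℝ := ∫ x : EucSpace n, Real.exp (-(1 / 2) * quadForm M x) with hKdef
  have hκ := fourierConst_pos n
  have h0 : 0 ≤ fourierConst n * (‖c‖ * K) := by positivity
  -- The sum dominates the constants of both bounds; the `1` keeps it positive when `c = 0`.
  refine ⟨‖c‖ + fourierConst n * (‖c‖ * K) + 1, by positivity, ?_, ?_⟩
  · filter_upwards [hψ] with x hx
    rw [hx, norm_gaussianFun]
    refine mul_le_mul (by linarith) (Real.exp_le_exp.2 ?_) (Real.exp_pos _).le (by positivity)
    linarith [hAM x]
  · filter_upwards [unitaryFourier_ae_eq_fourierLine (hint.congr hψ.symm)] with p hp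
    rw [hp, fourierLine_congr hψ, fourierLine_gaussianFun hM, norm_mul, norm_mul, norm_mul,
      Complex.norm_real, Complex.norm_real, Complex.norm_real, Real.norm_eq_abs,
      Real.norm_eq_abs, Real.norm_eq_abs, Real.abs_exp, abs_of_pos hκ, ← hKdef, abs_of_pos hK,
      ← mul_assoc]
    refine mul_le_mul (by linarith [norm_nonneg c]) (Real.exp_le_exp.2 ?_) (Real.exp_pos _).le
      (by positivity)
    linarith [hBM p]

theorem ne_zero_of_ae_eq_gaussianFun {ψ : L2Space n} {c : ℂ} (hc : c ≠ 0)
    (hψ : ψ =ᵐ[volume] gaussianFun M c) : ψ ≠ 0 := by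
  rintro rfl
  have h1 : gaussianFun M c =ᵐ[volume] fun _ => 0 := hψ.symm.trans (Lp.coeFn_zero ℂ 2 volume)
  have h2 := (Continuous.ae_eq_iff_eq volume (continuous_gaussianFun M c) continuous_const).1 h1
  have h3 := congrFun h2 0
  simp [gaussianFun, quadForm_zero, hc] at h3

theorem eq_zero_of_ae_eq_gaussianFun_zero {ψ : L2Space n} (h : ψ =ᵐ[volume] gaussianFun A 0) :
    ψ = 0 := by
  refine Lp.ext (h.trans ?_)
  filter_upwards [Lp.coeFn_zero ℂ 2 (volume : Measure (EucSpace n))] with x hx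
  rw [hx, gaussianFun, zero_mul]
  rfl

/-- Existence of a nonzero function satisfying the Hardy inequalities forces `B ≤ A⁻¹`. -/
theorem HardyBounds.quadForm_le {ψ : L2Space n} (hA : A.PosDef) (hB : B.PosDef) (hψ : ψ ≠ 0)
    (h : HardyBounds A B C ψ) (p : EucSpace n) : quadForm B p ≤ quadForm A⁻¹ p := by
  by_contra! hp
  have hm : AEStronglyMeasurable (ψ : EucSpace n → ℂ) := Lp.aestronglyMeasurable ψ
  have hz := fourierLine_eq_zero hA hB hm h.1 (h.norm_fourierLine_le hA) hp
  have h1 := ae_eq_gaussianFun_of_fourierLine hA (integrable_of_le_gaussian hA hm h.1) (c := 0)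
    (fun p => by rw [hz, zero_mul, zero_mul])
  exact hψ (eq_zero_of_ae_eq_gaussianFun_zero h1)

/-- In the critical case `B = A⁻¹` the Hardy inequalities characterise Gaussians. -/
theorem HardyBounds.exists_gaussianFun {ψ : L2Space n} (hA : A.PosDef)
    (hAB : ∀ p : EucSpace n, quadForm B p = quadForm A⁻¹ p) (h : HardyBounds A B C ψ) :
    ∃ c : ℂ, ψ =ᵐ[volume] gaussianFun A c := by
  have hm : AEStronglyMeasurable (ψ : EucSpace n → ℂ) := Lp.aestronglyMeasurable ψ
  have hg := fourierLine_eq_gaussian hA hm h.1 (D := C / fourierConst n)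
    (fun p => by rw [← hAB]; exact h.norm_fourierLine_le hA p)
  have hK : ((∫ x : EucSpace n, Real.exp (-(1 / 2) * quadForm A x) : ℝ) : ℂ) ≠ 0 :=
    Complex.ofReal_ne_zero.2 (integral_exp_neg_quadForm_pos hA).ne'
  refine ⟨fourierLine ψ 0 0 0 / (∫ x : EucSpace n, Real.exp (-(1 / 2) * quadForm A x) : ℝ),
    ae_eq_gaussianFun_of_fourierLine hA (integrable_of_le_gaussian hA hm h.1) fun p => ?_⟩
  rw [div_mul_cancel₀ _ hK]
  exact hg p

end Hardy

/-! ### The main theorem -/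

theorem mainTheorem6 (n : ℕ) (A B : Matrix (Fin n) (Fin n) ℝ) (hA : A.PosDef) (hB : B.PosDef) :
    ((∃ ψ : L2Space n, ψ ≠ 0 ∧ ∃ C : ℝ, 0 < C ∧ HardyBounds A B C ψ) ↔
      IsDualPair (ellipsoid A) (ellipsoid B)) ∧
    (polarDual (ellipsoid A) = ellipsoid B ↔
      ∀ ψ : L2Space n,
        (ψ ≠ 0 ∧ ∃ C : ℝ, 0 < C ∧ HardyBounds A B C ψ) ↔
          ∃ c : ℂ, c ≠ 0 ∧
            ∀ᵐ x : EucSpace n, ψ x = c * (Real.exp (-(1 / 2) * quadForm A x) : ℂ)) := by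
  rw [isDualPair_ellipsoid_iff hA hB, polarDual_ellipsoid_eq_iff hA hB]
  refine ⟨⟨?_, fun h => ?_⟩, fun h ψ => ⟨?_, ?_⟩, fun h => ?_⟩
  · rintro ⟨ψ, hψ, C, -, h⟩ p
    exact h.quadForm_le hA hB hψ p
  · have hφ := (memLp_gaussianFun hA 1).coeFn_toLp
    exact ⟨_, ne_zero_of_ae_eq_gaussianFun one_ne_zero hφ,
      exists_hardyBounds_gaussianFun hA (fun _ => le_rfl) h hφ⟩
  · rintro ⟨hψ, C, -, hC⟩
    obtain ⟨c, hc⟩ := hC.exists_gaussianFun hA h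
    refine ⟨c, ?_, hc⟩
    rintro rfl
    exact hψ (eq_zero_of_ae_eq_gaussianFun_zero (A := A) hc)
  · rintro ⟨c, hc, hψ⟩
    exact ⟨ne_zero_of_ae_eq_gaussianFun (M := A) hc hψ,
      exists_hardyBounds_gaussianFun hA (fun _ => le_rfl) (fun p => (h p).le) hψ⟩
  -- The hypothesis is tested on two Gaussians: that of `A` yields `B ≤ A⁻¹`, hence `A ≤ B⁻¹`, which
  -- makes that of `B⁻¹` admissible and so a multiple of the first.
  · have hφ := (memLp_gaussianFun hA 1).coeFn_toLp
    obtain ⟨hne, C, -, hC⟩ := (h _).2 ⟨1, one_ne_zero, hφ⟩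
    have hle := hC.quadForm_le hA hB hne
    have hχ := (memLp_gaussianFun hB.inv 1).coeFn_toLp
    obtain ⟨c, -, hc⟩ := (h _).1 ⟨ne_zero_of_ae_eq_gaussianFun one_ne_zero hχ,
      exists_hardyBounds_gaussianFun hB.inv (quadForm_le_inv hA hB hle)
        (fun p => by rw [inv_inv_of_posDef hB]) hχ⟩
    have heq : gaussianFun B⁻¹ 1 = gaussianFun A c :=
      (Continuous.ae_eq_iff_eq volume (continuous_gaussianFun _ _)
        (continuous_gaussianFun _ _)).1 (hχ.symm.trans hc)
    have hc1 : c = 1 := by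
      have := congrFun heq 0
      simpa [gaussianFun, quadForm_zero] using this.symm
    have hq : ∀ x : EucSpace n, quadForm B⁻¹ x = quadForm A x := fun x => by
      have h1 := congrArg norm (congrFun heq x)
      rw [norm_gaussianFun, norm_gaussianFun, hc1, norm_one, one_mul, one_mul,
        Real.exp_eq_exp] at h1
      linarith
    refine fun p => le_antisymm (hle p) ?_
    have hinv := quadForm_le_inv hA.inv hB.inv
      (fun x => by rw [inv_inv_of_posDef hA]; exact (hq x).le) p
    rwa [inv_inv_of_posDef hB] at hinv
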